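/- Let $A$ be a Noetherian commutative ring, $I\subseteq A$ an ideal and $x_1,\dots,x_r$ ($r\ge 0$) an $A$-regular sequence contained in $I$; regularity includes $(x_1,\dots,x_r)\neq A$. Assume that either (a) $A$ is a local ring, or (b) $A=\bigoplus_{n\ge 0}A_n$ is a standard graded ring, i.e. $A_0$ is a local ring (for example a field) and $A$ is generated by $A_1$ over $A_0$, and the ideal $I$ and the elements $x_1,\dots,x_r$ are homogeneous. For $i\ge 0$ let $H^i_I(A)=\varinjlim_t \operatorname{Ext}^i_A(A/I^t,A)$ be the local cohomology modules. A sequence $y_1,\dots,y_s$ of elements of $I$ is called *coregular* for an $A$-module $M$ if $M\ne 0$, $\operatorname{Supp}(M)\subseteq V(I)$, and $$y_{i+1}\,\bigl(0:_M(y_1,\dots,y_i)\bigr)=0:_M(y_1,\dots,y_i)\qquad\text{for all } 0\le i\le s-1$$ (for $i=0$ this reads $y_1M=M$). Then the following conditions are equivalent: (i) $\sqrt{I}=\sqrt{(x_1,\dots,x_r)}$; (ii) $x_1,\dots,x_r$ is a coregular sequence for $H^r_I(A)$, and $H^i_I(A)=0$ for all $i>r$. -/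

import Mathlib

open scoped Pointwise

universe u

/-- An `ℕ`-grading `𝒜` of a commutative ring `A` is *standard* if `A` is generated as a ring by its
components of degree `0` and `1` (that is, `A = A₀[A₁]`), over a local ring `A₀` (for example, a
field). Noetherianity is a separate hypothesis. -/
structure IsStandardGraded {A : Type u} [CommRing A] (𝒜 : ℕ → AddSubgroup A) [GradedRing 𝒜] :
    Prop where
  isLocalRing_zero : IsLocalRing (𝒜 0)
  closure_eq_top : Subring.closure ((𝒜 0 : Set A) ∪ (𝒜 1 : Set A)) = ⊤

/-- A sequence `xs = [x₁, …, x_r]` of elements of the ideal `I` is *coregular* for the module `M`,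
which is non-zero and has `Supp M ⊆ V(I)`, if `x_{i+1}` maps `0 :_M (x₁, …, x_i)` onto itself
for all `0 ≤ i < r`. For `i = 0` this says `x₁ M = M`. -/
structure IsCoregular {A : Type u} [CommRing A] (I : Ideal A) (M : Type u) [AddCommGroup M]
    [Module A M] (xs : List A) : Prop where
  nontrivial : Nontrivial M
  support_subset : Module.support A M ⊆ PrimeSpectrum.zeroLocus (I : Set A)
  mem : ∀ x ∈ xs, x ∈ I
  smul_eq : ∀ (i : ℕ) (hi : i < xs.length),
    xs[i] • Submodule.torsionBySet A M (Ideal.ofList (xs.take i) : Set A) =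
      Submodule.torsionBySet A M (Ideal.ofList (xs.take i) : Set A)

/-! Write `K` for the ideal `(x₁, …, x_r)` and `H^i` for local cohomology supported in `I`. Both
conditions are equivalent to the vanishing of `H^i(A / K)` for all `i > 0`.

For (ii) this is an induction on the sequence (`isCoregularOn_and_subsingleton_iff`), run for any
weakly regular module `M`. In the long exact sequence of `0 → M → M → M / x₁M → 0`, regularity kills
`H^{r-1}(M)`, so the connecting map identifies `H^{r-1}(M / x₁M)` with the kernel of `x₁` on
`H^r(M)`. Coregularity of the remaining elements on that kernel is thus a statement about `M / x₁M`,
and surjectivity of `x₁` on `H^r(M)`, given vanishing above `r`, amounts to `H^r(M / x₁M) = 0`.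

If the radicals agree, `A / K` is `I`-power torsion. Over a Noetherian ring such a module has a
resolution by torsion injectives (Artin–Rees, `Module.injective_powTorsion`), so its higher local
cohomology vanishes. Its `H^0` is not zero, and hence neither is `H^r(A)`.

Conversely, let `H^i(A / K) = 0` for `i > 0`. Dividing out the torsion replaces `K` by its
saturation `K'`, and `A / K'` has no local cohomology at all. Noetherian induction, cutting down by
nonzerodivisors in `I`, gives `K' + I = A` (`sup_eq_top_of_subsingleton`). The local or graded
hypothesis turns this into `I = A` or `K' = A`. The former contradicts `H^r(A) ≠ 0`; the latter says
that a power of `I` lies in `K`. -/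

open CategoryTheory Limits Opposite

noncomputable section

/-! ### Comparison of the derived-functor `Ext` with `Abelian.Ext`. -/

namespace CategoryTheory.ProjectiveResolution

variable {A : Type u} [CommRing A] {X X' Y : ModuleCat.{u} A}

/-- The submodule of `n`-cocycles of the complex `Hom(P, Y)`. -/
def cocycles (P : ProjectiveResolution X) (Y : ModuleCat.{u} A) (n : ℕ) :
    Submodule A (P.complex.X n ⟶ Y) :=
  LinearMap.ker (Linear.leftComp A Y (P.complex.d (n + 1) n))

lemma mem_cocycles {P : ProjectiveResolution X} {n : ℕ} {f : P.complex.X n ⟶ Y} :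
    f ∈ P.cocycles Y n ↔ P.complex.d (n + 1) n ≫ f = 0 := Iff.rfl

/-- The submodule of `n`-coboundaries of the complex `Hom(P, Y)`. -/
def coboundaries (P : ProjectiveResolution X) (Y : ModuleCat.{u} A) (n : ℕ) :
    Submodule A (P.cocycles Y n) :=
  (LinearMap.range (Linear.leftComp A Y (P.complex.d n (n - 1)))).comap
    (P.cocycles Y n).subtype

lemma mem_coboundaries {P : ProjectiveResolution X} {n : ℕ} {f : P.cocycles Y n} :
    f ∈ P.coboundaries Y n ↔ ∃ g, P.complex.d n (n - 1) ≫ g = f.1 := Iff.rfl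

/-- The class of a cocycle in `Ext`, as a linear map. -/
def cocyclesToExt (P : ProjectiveResolution X) (Y : ModuleCat.{u} A) (n : ℕ) :
    P.cocycles Y n →ₗ[A] Abelian.Ext X Y n where
  toFun f := P.extMk f.1 (n + 1) rfl f.2
  map_add' f g := (P.add_extMk _ _ _ _ _ _).symm
  map_smul' a f := by
    have h := P.extMk_comp_mk₀ f.1 (n + 1) rfl f.2 (a • 𝟙 Y)
    rw [RingHom.id_apply, Abelian.Ext.smul_eq_comp_mk₀, h]
    congr 1

lemma cocyclesToExt_surjective (P : ProjectiveResolution X) (n : ℕ) :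
    Function.Surjective (P.cocyclesToExt Y n) := fun α ↦ by
  obtain ⟨f, hf, h⟩ := P.extMk_surjective α (n + 1) rfl
  exact ⟨⟨f, hf⟩, h⟩

/-- The resolution vanishes in cohomological degree `1`, so there are no nonzero coboundaries in
degree `0`. -/
lemma extMk_degree_zero_eq_zero_iff (P : ProjectiveResolution X) (f : P.complex.X 0 ⟶ Y)
    (hf : P.complex.d 1 0 ≫ f = 0) : P.extMk f 1 rfl hf = 0 ↔ f = 0 := by
  simp only [← P.extEquivCohomologyClass.apply_eq_iff_eq,
    extEquivCohomologyClass_extMk, extEquivCohomologyClass_zero,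
    CochainComplex.HomComplex.CohomologyClass.mk_eq_zero_iff]
  rw [CochainComplex.HomComplex.Cocycle.toSingleMk_mem_coboundaries_iff _ _ _ _ _ 1 (by simp)]
  have hz : IsZero (P.cochainComplex.X 1) := CochainComplex.isZero_of_isStrictlyLE _ 0 _ (by simp)
  constructor
  · rintro ⟨g, hg⟩
    rw [hz.eq_of_src g 0, comp_zero] at hg
    rw [← cancel_epi (P.cochainComplexXIso (-(0 : ℕ)) 0 rfl).hom, ← hg, comp_zero]
  · rintro rfl
    exact ⟨0, by simp⟩

lemma ker_cocyclesToExt (P : ProjectiveResolution X) (n : ℕ) :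
    LinearMap.ker (P.cocyclesToExt Y n) = P.coboundaries Y n := by
  ext f
  rw [LinearMap.mem_ker, mem_coboundaries]
  cases n with
  | succ p => exact P.extMk_eq_zero_iff f.1 (p + 1 + 1) rfl f.2 p rfl
  | zero =>
    -- Truncated subtraction makes this `d 0 0`, which is zero by shape, as degree `0` requires.
    have : P.complex.d 0 (0 - 1) = 0 := P.complex.shape _ _ (by simp)
    refine (P.extMk_degree_zero_eq_zero_iff f.1 f.2).trans ?_
    rw [this]
    exact ⟨fun h ↦ ⟨0, by rw [h, comp_zero]⟩, fun ⟨g, hg⟩ ↦ by rw [← hg, zero_comp]⟩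

lemma cocyclesToExt_comp {P : ProjectiveResolution X} {P' : ProjectiveResolution X'}
    {g : X' ⟶ X} (φ : Hom P' P g) {n : ℕ} (f : P.cocycles Y n) (f' : P'.cocycles Y n)
    (h : f'.1 = φ.hom.f n ≫ f.1) :
    P'.cocyclesToExt Y n f' = (Abelian.Ext.mk₀ g).comp (P.cocyclesToExt Y n f) (zero_add n) := by
  obtain ⟨_, hf⟩ := f'
  dsimp at h
  subst h
  exact (mk₀_comp_extMk f.1 (n + 1) rfl f.2 φ).symm

/-- Cocycles as cycles of the complex `Hom(P, Y)`. -/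
def cocyclesι (P : ProjectiveResolution X) (Y : ModuleCat.{u} A) (n : ℕ) :
    ModuleCat.of A (P.cocycles Y n) ⟶ (P.complex.linearYonedaObj A Y).X n :=
  ModuleCat.ofHom (P.cocycles Y n).subtype

lemma cocyclesι_d (P : ProjectiveResolution X) (Y : ModuleCat.{u} A) (n : ℕ) :
    P.cocyclesι Y n ≫ (P.complex.linearYonedaObj A Y).d n (n + 1) = 0 := by
  ext f
  exact f.2

/-- The class of a cocycle in the homology of `Hom(P, Y)`. -/
def cocyclesToHomology (P : ProjectiveResolution X) (Y : ModuleCat.{u} A) (n : ℕ) :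
    ModuleCat.of A (P.cocycles Y n) ⟶ (P.complex.linearYonedaObj A Y).homology n :=
  (P.complex.linearYonedaObj A Y).liftCycles (P.cocyclesι Y n) (n + 1) (by simp)
    (P.cocyclesι_d Y n) ≫ HomologicalComplex.homologyπ _ _

lemma exists_iCycles_eq (P : ProjectiveResolution X) {n : ℕ} (f : P.cocycles Y n) :
    ∃ c, (P.complex.linearYonedaObj A Y).iCycles n c = f.1 :=
  ⟨(P.complex.linearYonedaObj A Y).liftCycles (P.cocyclesι Y n) (n + 1) (by simp)
    (P.cocyclesι_d Y n) f,
    ConcreteCategory.congr_hom ((P.complex.linearYonedaObj A Y).liftCycles_i (P.cocyclesι Y n)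
      (n + 1) (by simp) (P.cocyclesι_d Y n)) f⟩

lemma cocyclesToHomology_eq (P : ProjectiveResolution X) {n : ℕ} (f : P.cocycles Y n)
    (c : (P.complex.linearYonedaObj A Y).cycles n)
    (h : (P.complex.linearYonedaObj A Y).iCycles n c = f.1) :
    P.cocyclesToHomology Y n f = (P.complex.linearYonedaObj A Y).homologyπ n c := by
  rw [cocyclesToHomology, ModuleCat.comp_apply]
  congr 1
  apply (ModuleCat.mono_iff_injective ((P.complex.linearYonedaObj A Y).iCycles n)).1 inferInstance
  rw [h]
  exact ConcreteCategory.congr_hom ((P.complex.linearYonedaObj A Y).liftCycles_i (P.cocyclesι Y n)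
      (n + 1) (by simp) (P.cocyclesι_d Y n)) f

lemma cocyclesToHomology_surjective (P : ProjectiveResolution X) (n : ℕ) :
    Function.Surjective (P.cocyclesToHomology Y n) := fun y ↦ by
  obtain ⟨c, rfl⟩ := (ModuleCat.epi_iff_surjective
    ((P.complex.linearYonedaObj A Y).homologyπ n)).1 inferInstance y
  refine ⟨⟨(P.complex.linearYonedaObj A Y).iCycles n c, ?_⟩, cocyclesToHomology_eq _ _ _ rfl⟩
  have := ConcreteCategory.congr_hom
    ((P.complex.linearYonedaObj A Y).iCycles_d n (n + 1)) c
  exact this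

/-- Together with `ker_cocyclesToExt`, this presents both versions of `Ext` as the same quotient,
cocycles modulo coboundaries. -/
lemma ker_cocyclesToHomology (P : ProjectiveResolution X) (n : ℕ) :
    LinearMap.ker (P.cocyclesToHomology Y n).hom = P.coboundaries Y n := by
  ext f
  let K := P.complex.linearYonedaObj A Y
  obtain ⟨c, hc⟩ := P.exists_iCycles_eq f
  rw [LinearMap.mem_ker, mem_coboundaries]
  change P.cocyclesToHomology Y n f = 0 ↔ _
  rw [cocyclesToHomology_eq P f c hc]
  have hprev : (ComplexShape.up ℕ).prev n = n - 1 := by cases n <;> simp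
  have hex : (ShortComplex.mk (K.toCycles (n - 1) n) (K.homologyπ n)
      (K.toCycles_comp_homologyπ _ _)).Exact :=
    ShortComplex.exact_of_g_is_cokernel _ (K.homologyIsCokernel (n - 1) n hprev)
  rw [ShortComplex.moduleCat_exact_iff] at hex
  constructor
  · intro h
    obtain ⟨g, hg⟩ := hex c h
    refine ⟨g, ?_⟩
    rw [← hc, ← hg]
    exact (ConcreteCategory.congr_hom (K.toCycles_i (n - 1) n) g).symm
  · rintro ⟨g, hg⟩
    have : K.toCycles (n - 1) n g = c := by
      apply (ModuleCat.mono_iff_injective (K.iCycles n)).1 inferInstance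
      rw [hc, ← hg]
      exact ConcreteCategory.congr_hom (K.toCycles_i (n - 1) n) g
    rw [← this]
    exact ConcreteCategory.congr_hom (K.toCycles_comp_homologyπ (n - 1) n) g

/-- The map of complexes `Hom(Q, Y) ⟶ Hom(P, Y)` induced by `P ⟶ Q`. -/
def _root_.ChainComplex.linearYonedaMap {P Q : ChainComplex (ModuleCat.{u} A) ℕ} (φ : P ⟶ Q)
    (Y : ModuleCat.{u} A) : Q.linearYonedaObj A Y ⟶ P.linearYonedaObj A Y :=
  (HomologicalComplex.unopFunctor _ _).map
    ((((linearYoneda A (ModuleCat.{u} A)).obj Y).rightOp.mapHomologicalComplex _).map φ).op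

/-- Two naturality squares, for left derived functors and for homology of the opposite complex, are
glued and read in the opposite category. -/
lemma isoExt_hom_naturality {P : ProjectiveResolution X} {P' : ProjectiveResolution X'}
    {g : X' ⟶ X} (φ : Hom P' P g) (Y : ModuleCat.{u} A) (n : ℕ) :
    ((Ext A (ModuleCat.{u} A) n).map g.op).app Y ≫ (P'.isoExt n Y).hom =
      (P.isoExt n Y).hom ≫ HomologicalComplex.homologyMap
        (ChainComplex.linearYonedaMap φ.hom Y) n := by
  have h1 := isoLeftDerivedObj_inv_naturality g P' P φ.hom
    (by simpa using φ.hom_f_zero_comp_π_f_zero)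
    ((linearYoneda A (ModuleCat.{u} A)).obj Y).rightOp n
  have h2 := HomologicalComplex.homologyOp_hom_naturality
    (ChainComplex.linearYonedaMap φ.hom Y) n
  exact congrArg Quiver.Hom.unop
    (((CommSq.mk h2).vert_inv.flip.horiz_comp (CommSq.mk h1)).w)

lemma homologyMap_cocyclesToHomology {P : ProjectiveResolution X} {P' : ProjectiveResolution X'}
    {g : X' ⟶ X} (φ : Hom P' P g) {n : ℕ} (f : P.cocycles Y n) (f' : P'.cocycles Y n)
    (h : f'.1 = φ.hom.f n ≫ f.1) :
    HomologicalComplex.homologyMap (ChainComplex.linearYonedaMap φ.hom Y) n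
      (P.cocyclesToHomology Y n f) = P'.cocyclesToHomology Y n f' := by
  obtain ⟨c, hc⟩ := P.exists_iCycles_eq f
  rw [cocyclesToHomology_eq P f c hc, cocyclesToHomology_eq P' f'
    (HomologicalComplex.cyclesMap (ChainComplex.linearYonedaMap φ.hom Y) n c),
    ← ModuleCat.comp_apply, HomologicalComplex.homologyπ_naturality, ModuleCat.comp_apply]
  rw [← ModuleCat.comp_apply, HomologicalComplex.cyclesMap_i, ModuleCat.comp_apply, hc, h]
  rfl

/-- `Ext`, defined by deriving `Hom(-, Y)`, agrees with `Abelian.Ext`: both are described by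
cocycles of a projective resolution. -/
def extLinearEquiv (P : ProjectiveResolution X) (Y : ModuleCat.{u} A) (n : ℕ) :
    ((Ext A (ModuleCat.{u} A) n).obj (op X)).obj Y ≃ₗ[A] Abelian.Ext X Y n :=
  (P.isoExt n Y).toLinearEquiv ≪≫ₗ
    ((P.cocyclesToHomology Y n).hom.quotKerEquivOfSurjective
      (P.cocyclesToHomology_surjective n)).symm ≪≫ₗ
    Submodule.quotEquivOfEq _ _ ((P.ker_cocyclesToHomology n).trans
      (P.ker_cocyclesToExt n).symm) ≪≫ₗ
    (P.cocyclesToExt Y n).quotKerEquivOfSurjective (P.cocyclesToExt_surjective n)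

lemma extLinearEquiv_eq (P : ProjectiveResolution X) {n : ℕ}
    (x : ((Ext A (ModuleCat.{u} A) n).obj (op X)).obj Y) (f : P.cocycles Y n)
    (h : (P.isoExt n Y).hom x = P.cocyclesToHomology Y n f) :
    P.extLinearEquiv Y n x = P.cocyclesToExt Y n f := by
  have : ((P.cocyclesToHomology Y n).hom.quotKerEquivOfSurjective
      (P.cocyclesToHomology_surjective n)).symm ((P.isoExt n Y).hom x) =
      Submodule.Quotient.mk f := by
    rw [h, LinearEquiv.symm_apply_eq]
    rfl
  change (P.cocyclesToExt Y n).quotKerEquivOfSurjective (P.cocyclesToExt_surjective n)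
    (Submodule.quotEquivOfEq _ _ ((P.ker_cocyclesToHomology n).trans
      (P.ker_cocyclesToExt n).symm) (((P.cocyclesToHomology Y n).hom.quotKerEquivOfSurjective
      (P.cocyclesToHomology_surjective n)).symm ((P.isoExt n Y).hom x))) = _
  rw [this]
  rfl

/-- Needed to match the transition maps of the two direct systems; a lift of `g` to the resolutions
computes both sides on cocycles. -/
lemma extLinearEquiv_naturality (P : ProjectiveResolution X) (P' : ProjectiveResolution X')
    (g : X' ⟶ X) {n : ℕ} (x : ((Ext A (ModuleCat.{u} A) n).obj (op X)).obj Y) :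
    P'.extLinearEquiv Y n (((Ext A (ModuleCat.{u} A) n).map g.op).app Y x) =
      (Abelian.Ext.mk₀ g).comp (P.extLinearEquiv Y n x) (zero_add n) := by
  let φ : P'.Hom P g := ⟨lift g P' P, by simpa using lift_commutes_zero g P' P⟩
  obtain ⟨f, hf⟩ := P.cocyclesToHomology_surjective n ((P.isoExt n Y).hom x)
  have hf' : φ.hom.f n ≫ f.1 ∈ P'.cocycles Y n := by
    rw [mem_cocycles, ← φ.hom.comm_assoc, mem_cocycles.1 f.2, comp_zero]
  rw [P.extLinearEquiv_eq x f hf.symm, P'.extLinearEquiv_eq _ ⟨_, hf'⟩,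
    cocyclesToExt_comp φ f ⟨_, hf'⟩ rfl]
  rw [← homologyMap_cocyclesToHomology φ f ⟨_, hf'⟩ rfl, hf]
  exact ConcreteCategory.congr_hom (isoExt_hom_naturality φ Y n) x

end CategoryTheory.ProjectiveResolution

/-! ### Local cohomology as a direct limit of `Abelian.Ext`. -/

namespace localCohomology

variable {A : Type u} [CommRing A] (I : Ideal A)

/-- The module `A ⧸ I ^ t`. -/
abbrev powQuot (t : ℕ) : ModuleCat.{u} A := ModuleCat.of A (A ⧸ I ^ t)

/-- The projection `A ⧸ I ^ t ⟶ A ⧸ I ^ s` for `s ≤ t`. -/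
def powQuotMap {s t : ℕ} (h : s ≤ t) : powQuot I t ⟶ powQuot I s :=
  (ringModIdeals (idealPowersDiagram I)).map (homOfLE h).op

lemma powQuotMap_self (t : ℕ) : powQuotMap I (le_refl t) = 𝟙 _ :=
  (ringModIdeals (idealPowersDiagram I)).map_id _

lemma powQuotMap_comp {r s t : ℕ} (h : r ≤ s) (h' : s ≤ t) :
    powQuotMap I h' ≫ powQuotMap I h = powQuotMap I (h.trans h') :=
  ((ringModIdeals (idealPowersDiagram I)).map_comp _ _).symm

lemma powQuotMap_epi {s t : ℕ} (h : s ≤ t) : Epi (powQuotMap I h) := by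
  rw [ModuleCat.epi_iff_surjective]
  intro y
  obtain ⟨a, rfl⟩ := Ideal.Quotient.mk_surjective y
  exact ⟨Ideal.Quotient.mk _ a, rfl⟩

/-- The transition maps of the direct system `Ext (A ⧸ I ^ t) M i`. -/
def extTransition (i : ℕ) (M : ModuleCat.{u} A) (s t : ℕ) (h : s ≤ t) :
    Abelian.Ext (powQuot I s) M i →ₗ[A] Abelian.Ext (powQuot I t) M i :=
  (Abelian.Ext.mk₀ (powQuotMap I h)).precompOfLinear A M (zero_add i)

lemma extTransition_apply {i : ℕ} {M : ModuleCat.{u} A} {s t : ℕ} (h : s ≤ t)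
    (x : Abelian.Ext (powQuot I s) M i) :
    extTransition I i M s t h x = (Abelian.Ext.mk₀ (powQuotMap I h)).comp x (zero_add i) := rfl

instance (i : ℕ) (M : ModuleCat.{u} A) : DirectedSystem
    (fun t ↦ Abelian.Ext (powQuot I t) M i) (extTransition I i M · · ·) where
  map_self t x := by simp [extTransition_apply, powQuotMap_self]
  map_map r s t h h' x := by
    simp [extTransition_apply, ← powQuotMap_comp I h h']

/-- The local cohomology module of `M` as the direct limit of `Abelian.Ext (A ⧸ I ^ t) M i`. -/
abbrev ExtLimit (i : ℕ) (M : ModuleCat.{u} A) : Type u :=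
  Module.DirectLimit (fun t ↦ Abelian.Ext (powQuot I t) M i) (extTransition I i M)

/-- The map from a term of the direct system. -/
abbrev ExtLimit.of (i : ℕ) (M : ModuleCat.{u} A) (t : ℕ) :
    Abelian.Ext (powQuot I t) M i →ₗ[A] ExtLimit I i M :=
  Module.DirectLimit.of A ℕ _ (extTransition I i M) t

/-- `Ext`, as used in the definition of local cohomology, in terms of `Abelian.Ext`. -/
def powQuotExtEquiv (i : ℕ) (M : ModuleCat.{u} A) (t : ℕ) :
    ((diagram (idealPowersDiagram I) i).obj (op (op t))).obj M ≃ₗ[A]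
      Abelian.Ext (powQuot I t) M i :=
  (CategoryTheory.projectiveResolution (powQuot I t)).extLinearEquiv M i

lemma powQuotExtEquiv_map {i : ℕ} {M : ModuleCat.{u} A} {s t : ℕ} (h : s ≤ t)
    (x : ((diagram (idealPowersDiagram I) i).obj (op (op s))).obj M) :
    powQuotExtEquiv I i M t (((diagram (idealPowersDiagram I) i).map (homOfLE h).op.op).app M x) =
      extTransition I i M s t h (powQuotExtEquiv I i M s x) :=
  ProjectiveResolution.extLinearEquiv_naturality _ _ (powQuotMap I h) x

/-- The comparison map on a term of the direct system. -/
def extToLocalCohomology (i : ℕ) (M : ModuleCat.{u} A) (t : ℕ) :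
    Abelian.Ext (powQuot I t) M i →ₗ[A] (localCohomology I i).obj M :=
  ((colimit.ι (diagram (idealPowersDiagram I) i) (op (op t))).app M).hom ∘ₗ
      (powQuotExtEquiv I i M t).symm.toLinearMap

lemma extToLocalCohomology_apply {i : ℕ} {M : ModuleCat.{u} A} {t : ℕ}
    (y : ((diagram (idealPowersDiagram I) i).obj (op (op t))).obj M) :
    extToLocalCohomology I i M t (powQuotExtEquiv I i M t y) =
      (colimit.ι (diagram (idealPowersDiagram I) i) (op (op t))).app M y :=
  congrArg ((colimit.ι (diagram (idealPowersDiagram I) i) (op (op t))).app M)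
    ((powQuotExtEquiv I i M t).symm_apply_apply y)

/-- The comparison map from `ExtLimit` to local cohomology. -/
def ExtLimit.toLocalCohomology (i : ℕ) (M : ModuleCat.{u} A) :
    ExtLimit I i M →ₗ[A] (localCohomology I i).obj M :=
  Module.DirectLimit.lift A ℕ _ _
    (extToLocalCohomology I i M) (by
    intro s t h x
    obtain ⟨y, rfl⟩ := (powQuotExtEquiv I i M s).surjective x
    rw [← powQuotExtEquiv_map, extToLocalCohomology_apply, extToLocalCohomology_apply]
    exact ConcreteCategory.congr_hom (congrArg (fun z ↦ z.app M)
      (colimit.w (diagram (idealPowersDiagram I) i) (homOfLE h).op.op)) y)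

lemma ExtLimit.toLocalCohomology_of {i : ℕ} {M : ModuleCat.{u} A} {t : ℕ}
    (y : ((diagram (idealPowersDiagram I) i).obj (op (op t))).obj M) :
    ExtLimit.toLocalCohomology I i M (ExtLimit.of I i M t (powQuotExtEquiv I i M t y)) =
      (colimit.ι (diagram (idealPowersDiagram I) i) (op (op t))).app M y := by
  rw [toLocalCohomology, Module.DirectLimit.lift_of, extToLocalCohomology_apply]

lemma ExtLimit.toLocalCohomology_bijective (i : ℕ) (M : ModuleCat.{u} A) :
    Function.Bijective (ExtLimit.toLocalCohomology I i M) := by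
  let hc := isColimitOfPreserves ((evaluation (ModuleCat.{u} A) (ModuleCat.{u} A)).obj M)
    (colimit.isColimit (diagram (idealPowersDiagram I) i))
  -- The index category of powers of `I` lives in universe `0`, not `u`.
  have : PreservesFilteredColimitsOfSize.{0, 0} (forget (ModuleCat.{u} A)) :=
    preservesFilteredColimitsOfSize_shrink.{0, u, 0, u} _
  constructor
  · rw [injective_iff_map_eq_zero]
    intro x hx
    obtain ⟨s, e, rfl⟩ := Module.DirectLimit.exists_of x
    obtain ⟨y, rfl⟩ := (powQuotExtEquiv I i M s).surjective e
    have h0 := (ExtLimit.toLocalCohomology_of I y).symm.trans hx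
    obtain ⟨k, f, g, h⟩ := Concrete.isColimit_exists_of_rep_eq _ hc y
      (0 : ((diagram (idealPowersDiagram I) i).obj (op (op s))).obj M)
        (h0.trans (map_zero _).symm)
    have hk : s ≤ unop (unop k) := leOfHom f.unop.unop
    have hy : ((diagram (idealPowersDiagram I) i).map (homOfLE hk).op.op).app M y = 0 :=
      h.trans (map_zero _)
    have := powQuotExtEquiv_map I hk y
    rw [hy, map_zero] at this
    rw [← Module.DirectLimit.of_f (hij := hk), ← this, map_zero]
  · intro y
    obtain ⟨k, z, hz⟩ := Concrete.isColimit_exists_rep _ hc y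
    exact ⟨_, (ExtLimit.toLocalCohomology_of I (t := unop (unop k)) z).trans hz⟩

/-- Local cohomology as the direct limit of `Abelian.Ext (A ⧸ I ^ t) M i`. -/
def extLimitEquiv (i : ℕ) (M : ModuleCat.{u} A) :
    ExtLimit I i M ≃ₗ[A] (localCohomology I i).obj M :=
  LinearEquiv.ofBijective _ (ExtLimit.toLocalCohomology_bijective I i M)

end localCohomology

/-! ### Functoriality, long exact sequences and degree zero. -/

namespace localCohomology

variable {A : Type u} [CommRing A] (I : Ideal A)

section powQuot

variable {I}

lemma powQuot_smul_id {t : ℕ} {a : A} (ha : a ∈ I ^ t) : a • 𝟙 (powQuot I t) = 0 := by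
  ext
  change a • Ideal.Quotient.mk (I ^ t) 1 = 0
  rw [← Ideal.Quotient.mk_eq_mk, ← Submodule.Quotient.mk_smul, Submodule.Quotient.mk_eq_zero]
  simpa using ha

lemma powQuot_hom_ext {t : ℕ} {M : ModuleCat.{u} A} {f g : powQuot I t ⟶ M}
    (h : f (Ideal.Quotient.mk _ 1) = g (Ideal.Quotient.mk _ 1)) : f = g := by
  ext
  exact h

lemma powQuot_smul_hom_one {t : ℕ} {M : ModuleCat.{u} A} (f : powQuot I t ⟶ M) {a : A}
    (ha : a ∈ I ^ t) : a • f (Ideal.Quotient.mk _ 1) = 0 := by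
  have : a • f = 0 := by
    rw [← Category.id_comp f, ← Linear.smul_comp, powQuot_smul_id ha, zero_comp]
  exact ConcreteCategory.congr_hom this (Ideal.Quotient.mk _ 1)

/-- The map `A ⧸ I ^ t ⟶ M` sending `1` to an element killed by `I ^ t`. -/
def powQuotDesc {t : ℕ} {M : ModuleCat.{u} A} (m : M) (hm : ∀ a ∈ I ^ t, a • m = 0) :
    powQuot I t ⟶ M :=
  ModuleCat.ofHom ((I ^ t).liftQ (LinearMap.toSpanSingleton A M m) (fun a ha ↦ hm a ha))

lemma powQuotDesc_one {t : ℕ} {M : ModuleCat.{u} A} (m : M) (hm : ∀ a ∈ I ^ t, a • m = 0) :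
    powQuotDesc m hm (Ideal.Quotient.mk _ 1) = m :=
  one_smul A m

end powQuot

namespace ExtLimit

/-- The map on direct limits induced by postcomposition with a class in `Ext`. -/
def postcomp {M N : ModuleCat.{u} A} {n : ℕ} (β : Abelian.Ext M N n) {i k : ℕ} (h : i + n = k) :
    ExtLimit I i M →ₗ[A] ExtLimit I k N :=
  Module.DirectLimit.map (fun t ↦ β.postcompOfLinear A (powQuot I t) h) (fun s t hst ↦ by
    ext x
    exact Abelian.Ext.comp_assoc _ _ _ (zero_add i) h (by lia))

lemma postcomp_of {M N : ModuleCat.{u} A} {n : ℕ} (β : Abelian.Ext M N n) {i k : ℕ}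
    (h : i + n = k) {t : ℕ} (x : Abelian.Ext (powQuot I t) M i) :
    postcomp I β h (ExtLimit.of I i M t x) = ExtLimit.of I k N t (x.comp β h) :=
  Module.DirectLimit.map_apply_of _ _ _

/-- Functoriality of local cohomology in the module. -/
abbrev map (i : ℕ) {M N : ModuleCat.{u} A} (f : M ⟶ N) : ExtLimit I i M →ₗ[A] ExtLimit I i N :=
  postcomp I (Abelian.Ext.mk₀ f) (add_zero i)

/-- The connecting homomorphism. -/
abbrev δ {S : ShortComplex (ModuleCat.{u} A)} (hS : S.ShortExact) {i k : ℕ} (h : i + 1 = k) :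
    ExtLimit I i S.X₃ →ₗ[A] ExtLimit I k S.X₁ :=
  postcomp I hS.extClass h

variable {I}

/-- A class that dies in the limit already dies at a finite stage, so exactness of the `Ext`
sequences passes to the limit. -/
lemma exists_of_postcomp_eq_zero {M N : ModuleCat.{u} A} {n : ℕ} {β : Abelian.Ext M N n} {i k : ℕ}
    {h : i + n = k} {x : ExtLimit I i M} (hx : postcomp I β h x = 0) :
    ∃ (t : ℕ) (e : Abelian.Ext (powQuot I t) M i), ExtLimit.of I i M t e = x ∧ e.comp β h = 0 := by
  obtain ⟨s, e, rfl⟩ := Module.DirectLimit.exists_of x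
  rw [postcomp_of] at hx
  obtain ⟨t, hst, h0⟩ := Module.DirectLimit.of.zero_exact hx
  refine ⟨t, extTransition I i M s t hst e, Module.DirectLimit.of_f, ?_⟩
  rw [← h0]
  exact Abelian.Ext.comp_assoc _ _ _ (zero_add i) h (by lia)

lemma map_smul_id (i : ℕ) {M : ModuleCat.{u} A} (a : A) (x : ExtLimit I i M) :
    map I i (a • 𝟙 M) x = a • x := by
  obtain ⟨s, e, rfl⟩ := Module.DirectLimit.exists_of x
  rw [postcomp_of, ← Abelian.Ext.smul_eq_comp_mk₀, map_smul]

lemma map_comp_apply (i : ℕ) {M N P : ModuleCat.{u} A} (f : M ⟶ N) (g : N ⟶ P)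
    (x : ExtLimit I i M) : map I i (f ≫ g) x = map I i g (map I i f x) := by
  obtain ⟨s, e, rfl⟩ := Module.DirectLimit.exists_of x
  simp [postcomp_of]

lemma map_id_apply (i : ℕ) {M : ModuleCat.{u} A} (x : ExtLimit I i M) :
    map I i (𝟙 M) x = x := by
  simpa using map_smul_id i (1 : A) x

lemma subsingleton_of_iso {i : ℕ} {M N : ModuleCat.{u} A} (e : M ≅ N)
    [Subsingleton (ExtLimit I i M)] : Subsingleton (ExtLimit I i N) :=
  Function.Surjective.subsingleton (f := map I i e.hom) fun x ↦
    ⟨map I i e.inv x, by rw [← map_comp_apply, e.inv_hom_id, map_id_apply]⟩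

section exact

variable {S : ShortComplex (ModuleCat.{u} A)} (hS : S.ShortExact)

include hS in
lemma exact₂ {i : ℕ} {x : ExtLimit I i S.X₂} (hx : map I i S.g x = 0) :
    ∃ y, map I i S.f y = x := by
  obtain ⟨t, e, rfl, he⟩ := exists_of_postcomp_eq_zero hx
  obtain ⟨e', rfl⟩ := Abelian.Ext.covariant_sequence_exact₂ _ hS e he
  exact ⟨ExtLimit.of I i _ t e', postcomp_of I _ _ _⟩

lemma exact₃ {i k : ℕ} {h : i + 1 = k} {x : ExtLimit I i S.X₃} (hx : δ I hS h x = 0) :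
    ∃ y, map I i S.g y = x := by
  obtain ⟨t, e, rfl, he⟩ := exists_of_postcomp_eq_zero hx
  obtain ⟨e', rfl⟩ := Abelian.Ext.covariant_sequence_exact₃ _ hS e h he
  exact ⟨ExtLimit.of I i _ t e', postcomp_of I _ _ _⟩

lemma exact₁ {i k : ℕ} (h : i + 1 = k) {x : ExtLimit I k S.X₁} (hx : map I k S.f x = 0) :
    ∃ y, δ I hS h y = x := by
  obtain ⟨t, e, rfl, he⟩ := exists_of_postcomp_eq_zero hx
  obtain ⟨e', rfl⟩ := Abelian.Ext.covariant_sequence_exact₁ _ hS e he h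
  exact ⟨ExtLimit.of I i _ t e', postcomp_of I _ _ _⟩

lemma δ_map_g {i k : ℕ} {h : i + 1 = k} (x : ExtLimit I i S.X₂) :
    δ I hS h (map I i S.g x) = 0 := by
  obtain ⟨s, e, rfl⟩ := Module.DirectLimit.exists_of x
  simp [postcomp_of]

lemma map_f_δ {i k : ℕ} {h : i + 1 = k} (x : ExtLimit I i S.X₃) :
    map I k S.f (δ I hS h x) = 0 := by
  obtain ⟨s, e, rfl⟩ := Module.DirectLimit.exists_of x
  simp [postcomp_of]

include hS in
lemma subsingleton_X₃ {i : ℕ} [Subsingleton (ExtLimit I i S.X₂)]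
    [Subsingleton (ExtLimit I (i + 1) S.X₁)] : Subsingleton (ExtLimit I i S.X₃) := by
  refine subsingleton_of_forall_eq 0 fun x ↦ ?_
  obtain ⟨y, rfl⟩ := exact₃ hS (Subsingleton.elim (δ I hS rfl x) 0)
  rw [Subsingleton.elim y 0, map_zero]

end exact

lemma exists_pow_smul_eq_zero {i : ℕ} {M : ModuleCat.{u} A} (x : ExtLimit I i M) :
    ∃ n : ℕ, ∀ a ∈ I ^ n, a • x = 0 := by
  obtain ⟨t, e, rfl⟩ := Module.DirectLimit.exists_of x
  refine ⟨t, fun a ha ↦ ?_⟩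
  have : a • e = 0 := by
    rw [← Abelian.Ext.mk₀_id_comp (a • e), Abelian.Ext.comp_smul, ← Abelian.Ext.smul_comp,
      ← Abelian.Ext.mk₀_smul, powQuot_smul_id ha, Abelian.Ext.mk₀_zero, Abelian.Ext.zero_comp]
  rw [← map_smul, this, map_zero]

/-- Every element is killed by a power of `a`, because local cohomology is `I`-power torsion. -/
lemma subsingleton_of_smul_injective {i : ℕ} {M : ModuleCat.{u} A} {a : A} (ha : a ∈ I)
    (h : ∀ x : ExtLimit I i M, a • x = 0 → x = 0) : Subsingleton (ExtLimit I i M) := by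
  refine subsingleton_of_forall_eq 0 fun x ↦ ?_
  obtain ⟨n, hn⟩ := exists_pow_smul_eq_zero x
  have key : ∀ n : ℕ, a ^ n • x = 0 → x = 0 := by
    intro n
    induction n with
    | zero => simp
    | succ n ih => exact fun hx ↦ ih (h _ (by rwa [smul_smul, ← pow_succ']))
  exact key n (hn _ (Ideal.pow_mem_pow ha n))

lemma exists_degree_zero_of {M : ModuleCat.{u} A} (x : ExtLimit I 0 M) :
    ∃ (t : ℕ) (f : powQuot I t ⟶ M), ExtLimit.of I 0 M t (Abelian.Ext.mk₀ f) = x := by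
  obtain ⟨t, e, rfl⟩ := Module.DirectLimit.exists_of x
  obtain ⟨f, rfl⟩ := Abelian.Ext.mk₀_bijective _ _ |>.2 e
  exact ⟨t, f, rfl⟩

/-- `H^0` is the `I`-power torsion of `M`: a torsion element is a map out of some `A ⧸ I ^ n`, and
it survives in the limit because the transition maps are epimorphisms. -/
lemma subsingleton_zero_iff {M : ModuleCat.{u} A} : Subsingleton (ExtLimit I 0 M) ↔
    ∀ (m : M) (n : ℕ), (∀ a ∈ I ^ n, a • m = 0) → m = 0 := by
  constructor
  · intro h m n hm
    have h0 : ExtLimit.of I 0 M n (Abelian.Ext.mk₀ (powQuotDesc m hm)) = 0 := Subsingleton.elim _ _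
    obtain ⟨t, hnt, h1⟩ := Module.DirectLimit.of.zero_exact h0
    rw [extTransition_apply, Abelian.Ext.mk₀_comp_mk₀, Abelian.Ext.mk₀_eq_zero_iff] at h1
    have := powQuotMap_epi I hnt
    rw [← powQuotDesc_one m hm, (cancel_epi (powQuotMap I hnt)).1 (h1.trans comp_zero.symm)]
    rfl
  · refine fun h ↦ subsingleton_of_forall_eq 0 fun x ↦ ?_
    obtain ⟨t, f, rfl⟩ := exists_degree_zero_of x
    have : f = 0 := powQuot_hom_ext (h _ t fun a ha ↦ powQuot_smul_hom_one f ha)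
    rw [this, Abelian.Ext.mk₀_zero, map_zero]

lemma map_zero_surjective {M N : ModuleCat.{u} A} (g : M ⟶ N)
    (hg : ∀ (y : N) (n : ℕ), (∀ a ∈ I ^ n, a • y = 0) →
      ∃ (x : M) (k : ℕ), (∀ a ∈ I ^ k, a • x = 0) ∧ g x = y) :
    Function.Surjective (map I 0 g) := by
  intro z
  obtain ⟨t, f, rfl⟩ := exists_degree_zero_of z
  obtain ⟨x, k, hx, hxy⟩ := hg _ t fun a ha ↦ powQuot_smul_hom_one f ha
  have hx' : ∀ a ∈ I ^ (max t k), a • x = 0 :=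
    fun a ha ↦ hx a (Ideal.pow_le_pow_right (le_max_right t k) ha)
  refine ⟨ExtLimit.of I 0 M _ (Abelian.Ext.mk₀ (powQuotDesc x hx')), ?_⟩
  rw [postcomp_of, ← Module.DirectLimit.of_f (hij := le_max_left t k), extTransition_apply,
    Abelian.Ext.mk₀_comp_mk₀, Abelian.Ext.mk₀_comp_mk₀]
  congr 2
  refine powQuot_hom_ext ?_
  rw [ModuleCat.comp_apply, ModuleCat.comp_apply, powQuotDesc_one, hxy]
  rfl

lemma subsingleton_succ_of_injective (i : ℕ) (E : ModuleCat.{u} A) [Injective E] :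
    Subsingleton (ExtLimit I (i + 1) E) := by
  refine subsingleton_of_forall_eq 0 fun x ↦ ?_
  obtain ⟨t, e, rfl⟩ := Module.DirectLimit.exists_of x
  rw [Abelian.Ext.eq_zero_of_injective e, map_zero]

end ExtLimit

end localCohomology

/-! ### Power torsion and injective modules. -/

variable {A : Type u} [CommRing A] (I : Ideal A)

/-- The submodule of elements killed by some power of `I`. -/
def Submodule.powTorsion (M : Type*) [AddCommGroup M] [Module A M] : Submodule A M where
  carrier := {m | ∃ n : ℕ, ∀ a ∈ I ^ n, a • m = 0}
  zero_mem' := ⟨0, by simp⟩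
  add_mem' := by
    rintro x y ⟨n, hn⟩ ⟨k, hk⟩
    refine ⟨max n k, fun a ha ↦ ?_⟩
    rw [smul_add, hn a (Ideal.pow_le_pow_right (le_max_left _ _) ha),
      hk a (Ideal.pow_le_pow_right (le_max_right _ _) ha), add_zero]
  smul_mem' := by
    rintro c x ⟨n, hn⟩
    exact ⟨n, fun a ha ↦ by rw [smul_comm, hn a ha, smul_zero]⟩

variable {I}

lemma Submodule.mem_powTorsion {M : Type*} [AddCommGroup M] [Module A M] {m : M} :
    m ∈ Submodule.powTorsion I M ↔ ∃ n : ℕ, ∀ a ∈ I ^ n, a • m = 0 := Iff.rfl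

lemma Submodule.exists_pow_smul_eq_zero_of_fg {M : Type*} [AddCommGroup M] [Module A M]
    {N : Submodule A M} (hN : N.FG) (h : N ≤ Submodule.powTorsion I M) :
    ∃ n : ℕ, ∀ m ∈ N, ∀ a ∈ I ^ n, a • m = 0 := by
  induction N, hN using Submodule.fg_induction with
  | singleton x =>
    obtain ⟨n, hn⟩ := h (Submodule.mem_span_singleton_self x)
    refine ⟨n, fun m hm a ha ↦ ?_⟩
    obtain ⟨c, rfl⟩ := Submodule.mem_span_singleton.1 hm
    rw [smul_comm, hn a ha, smul_zero]
  | sup N₁ N₂ _ _ h₁ h₂ =>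
    obtain ⟨n, hn⟩ := h₁ (le_sup_left.trans h)
    obtain ⟨k, hk⟩ := h₂ (le_sup_right.trans h)
    refine ⟨max n k, fun m hm a ha ↦ ?_⟩
    obtain ⟨x, hx, y, hy, rfl⟩ := Submodule.mem_sup.1 hm
    rw [smul_add, hn x hx a (Ideal.pow_le_pow_right (le_max_left _ _) ha),
      hk y hy a (Ideal.pow_le_pow_right (le_max_right _ _) ha), add_zero]

/-- Over a Noetherian ring, the `I`-power torsion of an injective module is injective. -/
lemma Module.injective_powTorsion [IsNoetherianRing A] (E : Type u) [AddCommGroup E] [Module A E]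
    [Module.Injective A E] : Module.Injective A (Submodule.powTorsion I E) := by
  refine Module.Baer.injective fun J g ↦ ?_
  obtain ⟨n, hn⟩ : ∃ n : ℕ, ∀ x : J, ∀ a ∈ I ^ n, a • g x = 0 := by
    obtain ⟨n, hn⟩ := Submodule.exists_pow_smul_eq_zero_of_fg (I := I)
      (N := LinearMap.range ((Submodule.powTorsion I E).subtype ∘ₗ g))
      (Module.Finite.iff_fg.1 (Module.Finite.range _)) (by rintro _ ⟨x, rfl⟩; exact (g x).2)
    exact ⟨n, fun x a ha ↦ Subtype.ext (hn _ ⟨x, rfl⟩ a ha)⟩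
  -- Artin–Rees: `J ∩ I ^ (k + n)` lies in `I ^ n J`, which `g` kills.
  obtain ⟨k, hk⟩ := I.exists_pow_inf_eq_pow_smul J
  have hker : Submodule.comap J.subtype (I ^ (k + n)) ≤
      LinearMap.ker ((Submodule.powTorsion I E).subtype ∘ₗ g) := by
    rintro ⟨x, hxJ⟩ hx
    have hx' : x ∈ I ^ n • (J : Submodule A A) := by
      have h1 : x ∈ I ^ (k + n) • (⊤ : Submodule A A) ⊓ J := ⟨by simpa using hx, hxJ⟩
      rw [hk (k + n) (by lia), Nat.add_sub_cancel_left] at h1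
      exact Submodule.smul_mono le_rfl inf_le_right h1
    have hle : I ^ n • (J : Submodule A A) ≤ (LinearMap.ker g).map J.subtype := by
      rw [Submodule.smul_le]
      intro a ha y hy
      refine ⟨a • ⟨y, hy⟩, ?_, rfl⟩
      rw [SetLike.mem_coe, LinearMap.mem_ker, map_smul, hn _ a ha]
    obtain ⟨y, hy, hyx⟩ := hle hx'
    obtain rfl : y = ⟨x, hxJ⟩ := Subtype.ext hyx
    rw [LinearMap.mem_ker, LinearMap.comp_apply, LinearMap.mem_ker.1 hy, map_zero]
  -- Extending to `A ⧸ I ^ (k + n)` rather than to `A` forces the values into the power torsion.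
  obtain ⟨h, hh⟩ := Module.Injective.out
    (Submodule.mapQ (Submodule.comap J.subtype (I ^ (k + n))) (I ^ (k + n)) J.subtype le_rfl)
    (by
      rw [← LinearMap.ker_eq_bot, Submodule.ker_mapQ, Submodule.mkQ_map_self])
    (Submodule.liftQ _ ((Submodule.powTorsion I E).subtype ∘ₗ g) hker)
  refine ⟨(h ∘ₗ (I ^ (k + n)).mkQ).codRestrict _ fun a ↦ ⟨k + n, fun b hb ↦ ?_⟩, fun x hx ↦ ?_⟩
  · have : (I ^ (k + n)).mkQ (b • a) = 0 :=
      (Submodule.Quotient.mk_eq_zero _).2 (Ideal.mul_mem_right _ _ hb)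
    rw [← map_smul, LinearMap.comp_apply, this, map_zero]
  · exact Subtype.ext (hh (Submodule.Quotient.mk ⟨x, hx⟩))

namespace localCohomology.ExtLimit

lemma _root_.Submodule.powTorsion_eq_top_of_surjective {M N : Type*} [AddCommGroup M] [Module A M]
    [AddCommGroup N] [Module A N] {f : M →ₗ[A] N} (hf : Function.Surjective f)
    (h : Submodule.powTorsion I M = ⊤) : Submodule.powTorsion I N = ⊤ := by
  refine eq_top_iff.2 fun y _ ↦ ?_
  obtain ⟨x, rfl⟩ := hf y
  obtain ⟨n, hn⟩ := Submodule.mem_powTorsion.1 (h ▸ Submodule.mem_top : x ∈ _)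
  exact ⟨n, fun a ha ↦ by rw [← map_smul, hn a ha, map_zero]⟩

lemma _root_.Submodule.powTorsion_powTorsion {M : Type*} [AddCommGroup M] [Module A M] :
    Submodule.powTorsion I (Submodule.powTorsion I M) = ⊤ := by
  refine eq_top_iff.2 ?_
  rintro ⟨x, n, hn⟩ -
  exact ⟨n, fun a ha ↦ Subtype.ext (hn a ha)⟩

/-- A module all of whose elements are killed by powers of `I` embeds into an injective one. -/
lemma exists_shortExact_of_powTorsion_eq_top [IsNoetherianRing A] (M : ModuleCat.{u} A)
    (hM : Submodule.powTorsion I M = ⊤) : ∃ (S : ShortComplex (ModuleCat.{u} A)),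
      S.X₁ = M ∧ S.ShortExact ∧ Injective S.X₂ ∧ Submodule.powTorsion I S.X₂ = ⊤ ∧
        Submodule.powTorsion I S.X₃ = ⊤ := by
  let E : ModuleCat.{u} A := Injective.under M
  have : Injective (ModuleCat.of A E) := Injective.injective_under M
  have : Module.Injective A E := Module.injective_module_of_injective_object A E
  have := Module.injective_powTorsion (I := I) E
  let ι : M ⟶ E := Injective.ι M
  have hι : Function.Injective ι :=
    (ModuleCat.mono_iff_injective _).1 (inferInstanceAs (Mono (Injective.ι M)))
  let f : M ⟶ ModuleCat.of A (Submodule.powTorsion I E) :=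
    ModuleCat.ofHom (ι.hom.codRestrict _ fun m ↦ by
      obtain ⟨n, hn⟩ := Submodule.mem_powTorsion.1 (hM ▸ Submodule.mem_top : m ∈ _)
      exact ⟨n, fun a ha ↦ by rw [← map_smul, hn a ha, map_zero]⟩)
  have hf : Mono f := by
    rw [ModuleCat.mono_iff_injective]
    exact fun x y hxy ↦ hι (congrArg Subtype.val hxy)
  refine ⟨ShortComplex.mk f (cokernel.π f) (cokernel.condition f), rfl,
    { exact := ShortComplex.exact_cokernel f, mono_f := hf,
      epi_g := inferInstanceAs (Epi (cokernel.π f)) },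
    Module.injective_object_of_injective_module A _, Submodule.powTorsion_powTorsion,
    Submodule.powTorsion_eq_top_of_surjective (f := (cokernel.π f).hom)
      ((ModuleCat.epi_iff_surjective _).1 inferInstance) Submodule.powTorsion_powTorsion⟩

/-- Dimension shifting along an embedding into a torsion injective whose cokernel is again torsion.
-/
lemma subsingleton_succ_of_powTorsion_eq_top [IsNoetherianRing A] (i : ℕ) :
    ∀ M : ModuleCat.{u} A, Submodule.powTorsion I M = ⊤ →
      Subsingleton (ExtLimit I (i + 1) M) := by
  induction i with
  | zero =>
    intro M hM
    obtain ⟨S, rfl, hS, _, h₂, h₃⟩ := exists_shortExact_of_powTorsion_eq_top M hM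
    have := subsingleton_succ_of_injective (I := I) 0 S.X₂
    refine subsingleton_of_forall_eq 0 fun x ↦ ?_
    obtain ⟨y, rfl⟩ := exact₁ hS (zero_add 1) (Subsingleton.elim (map I 1 S.f x) 0)
    -- In degree one the connecting map is zero: on torsion modules `H^0` is the identity, so
    -- `H^0(S.g)` is onto.
    obtain ⟨z, rfl⟩ := map_zero_surjective (I := I) S.g (fun y _ _ ↦ by
      have := hS.epi_g
      obtain ⟨x, rfl⟩ := (ModuleCat.epi_iff_surjective S.g).1 inferInstance y
      obtain ⟨n, hn⟩ := Submodule.mem_powTorsion.1 (h₂ ▸ Submodule.mem_top : x ∈ _)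
      exact ⟨x, n, hn, rfl⟩) y
    exact δ_map_g hS z
  | succ i ih =>
    intro M hM
    obtain ⟨S, rfl, hS, _, h₂, h₃⟩ := exists_shortExact_of_powTorsion_eq_top M hM
    have := subsingleton_succ_of_injective (I := I) (i + 1) S.X₂
    have := ih _ h₃
    refine subsingleton_of_forall_eq 0 fun x ↦ ?_
    obtain ⟨y, rfl⟩ := exact₁ hS rfl (Subsingleton.elim (map I (i + 1 + 1) S.f x) 0)
    rw [Subsingleton.elim y 0, map_zero]

end localCohomology.ExtLimit

/-! ### Coregular sequences, recursively. -/

section IsCoregularOn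

variable {A H : Type*} [CommRing A] [AddCommGroup H] [Module A H]

/-- A recursive form of coregularity of a sequence on a submodule: the first element acts
surjectively on `T`, and the remaining ones are coregular on the part of `T` that it kills. -/
def Submodule.IsCoregularOn : List A → Submodule A H → Prop
  | [], _ => True
  | x :: xs, T => (∀ h ∈ T, ∃ h' ∈ T, x • h' = h) ∧ IsCoregularOn xs (T ⊓ torsionBy A H x)

lemma Submodule.mem_torsionBySet_ofList {xs : List A} {h : H} :
    h ∈ torsionBySet A H (Ideal.ofList xs : Set A) ↔ ∀ x ∈ xs, x • h = 0 := by
  rw [mem_torsionBySet_iff]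
  refine ⟨fun hh x hx ↦ hh ⟨x, Ideal.subset_span hx⟩, fun hh ↦ ?_⟩
  have : Ideal.ofList xs ≤ LinearMap.ker (LinearMap.toSpanSingleton A H h) :=
    Ideal.span_le.2 fun x hx ↦ hh x hx
  exact fun a ↦ this a.2

lemma Submodule.isCoregularOn_iff (xs : List A) (T : Submodule A H) : IsCoregularOn xs T ↔
    ∀ (i : ℕ) (hi : i < xs.length), ∀ h ∈ T ⊓ torsionBySet A H (Ideal.ofList (xs.take i) : Set A),
      ∃ h' ∈ T ⊓ torsionBySet A H (Ideal.ofList (xs.take i) : Set A), xs[i] • h' = h := by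
  induction xs generalizing T with
  | nil => simp [IsCoregularOn]
  | cons x xs ih =>
    have h0 : T ⊓ torsionBySet A H (Ideal.ofList ((x :: xs).take 0) : Set A) = T := by
      ext h
      rw [mem_inf, mem_torsionBySet_ofList]
      simp
    have hs (i : ℕ) : T ⊓ torsionBySet A H (Ideal.ofList ((x :: xs).take (i + 1)) : Set A) =
        T ⊓ torsionBy A H x ⊓ torsionBySet A H (Ideal.ofList (xs.take i) : Set A) := by
      ext h
      rw [mem_inf, mem_inf, mem_inf, mem_torsionBySet_ofList, mem_torsionBySet_ofList]
      simp [and_assoc]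
    rw [IsCoregularOn, ih]
    constructor
    · rintro ⟨h₁, h₂⟩ (_ | i) hi
      · rw [h0]
        exact h₁
      · rw [hs]
        exact h₂ i (by simpa using hi)
    · intro h
      refine ⟨?_, fun i hi ↦ ?_⟩
      · have := h 0 (by simp)
        rwa [h0] at this
      · have := h (i + 1) (by simpa using hi)
        rwa [hs] at this

lemma Submodule.isCoregularOn_top_iff (xs : List A) :
    IsCoregularOn xs (⊤ : Submodule A H) ↔ ∀ (i : ℕ) (hi : i < xs.length),
      xs[i] • torsionBySet A H (Ideal.ofList (xs.take i) : Set A) =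
        torsionBySet A H (Ideal.ofList (xs.take i) : Set A) := by
  rw [isCoregularOn_iff]
  refine forall₂_congr fun i hi ↦ ?_
  rw [top_inf_eq]
  constructor
  · refine fun h ↦ le_antisymm ?_ fun y hy ↦ ?_
    · exact smul_le_self_of_tower _ _
    · exact (mem_smul_pointwise_iff_exists _ _ _).2 (h y hy)
  · intro h y hy
    rw [← h] at hy
    exact (mem_smul_pointwise_iff_exists _ _ _).1 hy

end IsCoregularOn

/-! ### Local cohomology modulo a regular sequence. -/

namespace localCohomology.ExtLimit

open RingTheory.Sequence

variable {A : Type u} [CommRing A] {I : Ideal A}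

lemma subsingleton_zero_of_isSMulRegular {M : ModuleCat.{u} A} {x : A} (hx : x ∈ I)
    (h : IsSMulRegular M x) : Subsingleton (ExtLimit I 0 M) :=
  subsingleton_zero_iff.2 fun _ n hm ↦
    (h.pow n) ((hm _ (Ideal.pow_mem_pow hx n)).trans (smul_zero _).symm)

section quotSMulTop

/-- The projection `M ⟶ M / x M`. -/
def quotSMulTopπ (M : ModuleCat.{u} A) (x : A) : M ⟶ ModuleCat.of A (QuotSMulTop x M) :=
  (M.smulShortComplex x).g

lemma smul_id_comp_quotSMulTopπ (M : ModuleCat.{u} A) (x : A) :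
    (x • 𝟙 M) ≫ quotSMulTopπ M x = 0 :=
  (M.smulShortComplex x).zero

variable {M : ModuleCat.{u} A} {x : A}

lemma shortExact_quotSMulTopπ (h : IsSMulRegular M x) :
    (ShortComplex.mk (x • 𝟙 M) (quotSMulTopπ M x) (smul_id_comp_quotSMulTopπ M x)).ShortExact :=
  h.smulShortComplex_shortExact

variable (I) in
/-- The connecting homomorphism of `0 ⟶ M ⟶ M ⟶ M / x M ⟶ 0`. -/
def δQuotSMulTop (h : IsSMulRegular M x) (i : ℕ) :
    ExtLimit I i (ModuleCat.of A (QuotSMulTop x M)) →ₗ[A] ExtLimit I (i + 1) M :=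
  δ I (shortExact_quotSMulTopπ h) rfl

lemma mapQuotSMulTop_smul {i : ℕ} (y : ExtLimit I i M) :
    map I i (quotSMulTopπ M x) (x • y) = 0 := by
  rw [← map_smul_id, ← map_comp_apply, smul_id_comp_quotSMulTopπ]
  obtain ⟨s, e, rfl⟩ := Module.DirectLimit.exists_of y
  simp [postcomp_of]

lemma smul_δQuotSMulTop (h : IsSMulRegular M x) {i : ℕ}
    (y : ExtLimit I i (ModuleCat.of A (QuotSMulTop x M))) : x • δQuotSMulTop I h i y = 0 := by
  rw [← map_smul_id]
  exact map_f_δ (shortExact_quotSMulTopπ h) y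

lemma exists_δQuotSMulTop_eq (h : IsSMulRegular M x) {i : ℕ} {y : ExtLimit I (i + 1) M}
    (hy : x • y = 0) : ∃ z, δQuotSMulTop I h i z = y := by
  rw [← map_smul_id] at hy
  exact exact₁ (shortExact_quotSMulTopπ h) rfl hy

lemma exists_smul_eq (h : IsSMulRegular M x) {i : ℕ} {y : ExtLimit I i M}
    (hy : map I i (quotSMulTopπ M x) y = 0) : ∃ z, x • z = y := by
  obtain ⟨z, hz⟩ := exact₂ (shortExact_quotSMulTopπ h) hy
  exact ⟨z, by rw [← map_smul_id, ← hz]⟩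

lemma exists_mapQuotSMulTop_eq (h : IsSMulRegular M x) {i : ℕ}
    {y : ExtLimit I i (ModuleCat.of A (QuotSMulTop x M))} (hy : δQuotSMulTop I h i y = 0) :
    ∃ z, map I i (quotSMulTopπ M x) z = y :=
  exact₃ (hS := shortExact_quotSMulTopπ h) hy

lemma subsingleton_of_quotSMulTop (hx : x ∈ I) (h : IsSMulRegular M x) (i : ℕ)
    [Subsingleton (ExtLimit I i (ModuleCat.of A (QuotSMulTop x M)))] :
    Subsingleton (ExtLimit I (i + 1) M) := by
  refine subsingleton_of_smul_injective hx fun y hy ↦ ?_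
  obtain ⟨z, rfl⟩ := exists_δQuotSMulTop_eq h hy
  rw [Subsingleton.elim z 0, map_zero]

lemma subsingleton_quotSMulTop (h : IsSMulRegular M x) (i : ℕ)
    [Subsingleton (ExtLimit I i M)] [Subsingleton (ExtLimit I (i + 1) M)] :
    Subsingleton (ExtLimit I i (ModuleCat.of A (QuotSMulTop x M))) := by
  refine subsingleton_of_forall_eq 0 fun y ↦ ?_
  obtain ⟨z, rfl⟩ := exists_mapQuotSMulTop_eq h (Subsingleton.elim (δQuotSMulTop I h i y) 0)
  rw [Subsingleton.elim z 0, map_zero]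

end quotSMulTop

/-- The kernel of `x` on `H^{i+1}(M)` comes from `H^i(M / xM)`, zero by induction; an injective
action of `x ∈ I` on a torsion module forces it to vanish. -/
lemma subsingleton_of_lt_length {xs : List A} (hxs : ∀ x ∈ xs, x ∈ I) {M : ModuleCat.{u} A}
    (hM : IsWeaklyRegular M xs) {i : ℕ} (hi : i < xs.length) : Subsingleton (ExtLimit I i M) := by
  induction xs generalizing M i with
  | nil => simp at hi
  | cons x xs ih =>
    rw [isWeaklyRegular_cons_iff] at hM
    have hx : x ∈ I := hxs x (by simp)
    cases i with
    | zero => exact subsingleton_zero_of_isSMulRegular hx hM.1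
    | succ i =>
      have := ih (fun y hy ↦ hxs y (by simp [hy])) (M := ModuleCat.of A (QuotSMulTop x M)) hM.2
        (i := i) (by simpa using hi)
      exact subsingleton_of_quotSMulTop hx hM.1 i

lemma subsingleton_of_linearEquiv {i : ℕ} {M N : Type u} [AddCommGroup M] [Module A M]
    [AddCommGroup N] [Module A N] (e : M ≃ₗ[A] N)
    (h : Subsingleton (ExtLimit I i (ModuleCat.of A M))) :
    Subsingleton (ExtLimit I i (ModuleCat.of A N)) :=
  subsingleton_of_iso e.toModuleIso

/-- The equivalence `M ⧸ () M ≃ M` for the empty sequence. -/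
def _root_.Submodule.quotOfListNilSMulTopEquiv (M : Type u) [AddCommGroup M] [Module A M] :
    (M ⧸ (Ideal.ofList ([] : List A) • ⊤ : Submodule A M)) ≃ₗ[A] M :=
  Submodule.quotEquivOfEqBot _ (by rw [Ideal.ofList_nil, Submodule.bot_smul])

/-- For a weakly `M`-regular sequence `xs` in `I`, coregularity on the local cohomology in degree
`xs.length` and vanishing above that degree can be read off the local cohomology of `M / xs M`. -/
lemma isCoregularOn_and_subsingleton_iff {H : Type*} [AddCommGroup H] [Module A H]
    {xs : List A} (hxs : ∀ x ∈ xs, x ∈ I) {M : ModuleCat.{u} A} (hM : IsWeaklyRegular M xs)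
    (j : ExtLimit I xs.length M →ₗ[A] H) (hj : Function.Injective j) :
    (Submodule.IsCoregularOn xs (LinearMap.range j) ∧
      ∀ i, xs.length < i → Subsingleton (ExtLimit I i M)) ↔
    ∀ i, Subsingleton (ExtLimit I (i + 1)
      (ModuleCat.of A (M ⧸ (Ideal.ofList xs • ⊤ : Submodule A M)))) := by
  -- The embedding `j` varies with `M`, while `H` stays fixed: each successive `0 :_H (x₁, …, x_i)`
  -- is the image of the local cohomology of a quotient.
  induction xs generalizing M with
  | nil =>
    let e := Submodule.quotOfListNilSMulTopEquiv (A := A) M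
    constructor
    · rintro ⟨-, h⟩ i
      exact subsingleton_of_linearEquiv e.symm (h (i + 1) (by simp))
    · refine fun h ↦ ⟨trivial, ?_⟩
      rintro (_ | i) hi
      · simp at hi
      · exact subsingleton_of_linearEquiv e (h i)
  | cons x xs ih =>
    have hM' := (isWeaklyRegular_cons_iff _ _ _).1 hM
    have hx : x ∈ I := hxs x (by simp)
    have hxs' : ∀ y ∈ xs, y ∈ I := fun y hy ↦ hxs y (by simp [hy])
    let N : ModuleCat.{u} A := ModuleCat.of A (QuotSMulTop x M)
    let d : ExtLimit I xs.length N →ₗ[A] ExtLimit I (xs.length + 1) M := δQuotSMulTop I hM'.1 _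
    -- The preceding term `H^{xs.length}(M)` vanishes by regularity.
    have hd : Function.Injective d := by
      rw [injective_iff_map_eq_zero]
      intro y hy
      obtain ⟨z, rfl⟩ := exists_mapQuotSMulTop_eq hM'.1 hy
      have : Subsingleton (ExtLimit I xs.length M) := subsingleton_of_lt_length hxs hM (by simp)
      rw [Subsingleton.elim z 0, map_zero]
    replace hj : ∀ y z : ExtLimit I (xs.length + 1) M, j y = j z → y = z := fun y z h ↦ hj h
    have hrange : LinearMap.range (j ∘ₗ d) = LinearMap.range j ⊓ Submodule.torsionBy A H x := by
      ext h
      constructor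
      · rintro ⟨y, rfl⟩
        refine ⟨⟨d y, rfl⟩, ?_⟩
        rw [SetLike.mem_coe, Submodule.mem_torsionBy_iff]
        exact (map_smul j x (d y)).symm.trans
          ((congrArg j (smul_δQuotSMulTop hM'.1 y)).trans (map_zero j))
      · rintro ⟨⟨y, rfl⟩, hy⟩
        rw [SetLike.mem_coe, Submodule.mem_torsionBy_iff] at hy
        obtain ⟨z, hz⟩ := exists_δQuotSMulTop_eq hM'.1
          (hj _ _ ((map_smul j x y).trans (hy.trans (map_zero j).symm)))
        exact ⟨z, congrArg j hz⟩
    have key := ih hxs' (M := N) hM'.2 (j ∘ₗ d)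
      (fun y z h ↦ hd (hj _ _ h))
    rw [hrange] at key
    let e : (M ⧸ (Ideal.ofList (x :: xs) • ⊤ : Submodule A M)) ≃ₗ[A]
        (N ⧸ (Ideal.ofList xs • ⊤ : Submodule A N)) :=
      Submodule.quotOfListConsSMulTopEquivQuotSMulTopInner M x xs
    have hsurj : (∀ h ∈ LinearMap.range j, ∃ h' ∈ LinearMap.range j, x • h' = h) ↔
        ∀ y : ExtLimit I (xs.length + 1) M, ∃ z, x • z = y := by
      constructor
      · intro h y
        obtain ⟨_, ⟨z, rfl⟩, hz⟩ := h (j y) ⟨y, rfl⟩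
        exact ⟨z, hj _ _ ((map_smul j x z).trans hz)⟩
      · rintro h _ ⟨y, rfl⟩
        obtain ⟨z, rfl⟩ := h y
        exact ⟨j z, ⟨z, rfl⟩, (map_smul j x z).symm⟩
    rw [Submodule.IsCoregularOn, hsurj]
    constructor
    · rintro ⟨⟨h₁, h₂⟩, h₃⟩ i
      refine subsingleton_of_linearEquiv e.symm (key.1 ⟨h₂, fun k hk ↦ ?_⟩ i)
      have : Subsingleton (ExtLimit I (k + 1) M) := h₃ (k + 1) (by simpa using hk)
      refine subsingleton_of_forall_eq 0 fun y ↦ ?_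
      obtain ⟨z, rfl⟩ := exists_mapQuotSMulTop_eq hM'.1
        (Subsingleton.elim (δQuotSMulTop I hM'.1 k y) 0)
      -- In the boundary degree `xs.length + 1`, `H^k(M)` need not vanish, but it maps to zero
      -- because `x` acts on it surjectively.
      rcases (Nat.succ_le_of_lt hk).eq_or_lt with rfl | hk'
      · obtain ⟨w, rfl⟩ := h₁ z
        exact mapQuotSMulTop_smul w
      · have : Subsingleton (ExtLimit I k M) := h₃ k (by simpa using hk')
        rw [Subsingleton.elim z 0, map_zero]
    · intro h
      obtain ⟨h₁, h₂⟩ := key.2 fun i ↦ subsingleton_of_linearEquiv e (h i)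
      refine ⟨⟨fun y ↦ ?_, h₁⟩, ?_⟩
      · have := h₂ _ (Nat.lt_succ_self _)
        exact exists_smul_eq hM'.1
          (Subsingleton.elim (α := ExtLimit I (xs.length + 1) N) (map I (xs.length + 1) (quotSMulTopπ M x) y) 0)
      · rintro (_ | i) hi
        · simp at hi
        · have := h₂ i (by simpa using hi)
          exact subsingleton_of_quotSMulTop hx hM'.1 i

/-- Used for the nonvanishing of `H^r(A)`. Since lower cohomology vanishes by regularity, vanishing
of the top one descends, one element and one degree at a time. -/
lemma subsingleton_zero_quotient {xs : List A} {M : ModuleCat.{u} A} (hM : IsWeaklyRegular M xs)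
    (hxs : ∀ x ∈ xs, x ∈ I) (h : Subsingleton (ExtLimit I xs.length M)) :
    Subsingleton (ExtLimit I 0
      (ModuleCat.of A (M ⧸ (Ideal.ofList xs • ⊤ : Submodule A M)))) := by
  induction xs generalizing M with
  | nil => exact subsingleton_of_linearEquiv (Submodule.quotOfListNilSMulTopEquiv (A := A) M).symm h
  | cons x xs ih =>
    have hM' := (isWeaklyRegular_cons_iff _ _ _).1 hM
    have h' : Subsingleton (ExtLimit I xs.length M) := subsingleton_of_lt_length hxs hM (by simp)
    replace h : Subsingleton (ExtLimit I (xs.length + 1) M) := h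
    have := subsingleton_quotSMulTop (I := I) hM'.1 xs.length
    exact subsingleton_of_linearEquiv
      (Submodule.quotOfListConsSMulTopEquivQuotSMulTopInner M x xs).symm
      (ih (M := ModuleCat.of A (QuotSMulTop x M)) hM'.2 (fun y hy ↦ hxs y (by simp [hy])) this)

end localCohomology.ExtLimit

/-! ### Saturation and the local or graded hypothesis. -/

section saturation

variable {A : Type u} [CommRing A] {I : Ideal A}

/-- The saturation `K : I ^ ∞` of an ideal. -/
def Ideal.powSaturation (K I : Ideal A) : Ideal A :=
  (Submodule.powTorsion I (A ⧸ K)).comap K.mkQ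

lemma Ideal.mem_powSaturation {K : Ideal A} {b : A} :
    b ∈ K.powSaturation I ↔ ∃ n : ℕ, ∀ a ∈ I ^ n, a * b ∈ K := by
  refine exists_congr fun _ ↦ forall₂_congr fun a _ ↦ ?_
  exact (Submodule.Quotient.mk_eq_zero K (x := a • b))

lemma Ideal.le_powSaturation (K I : Ideal A) : K ≤ K.powSaturation I :=
  fun _ hb ↦ Ideal.mem_powSaturation.2 ⟨0, fun a _ ↦ K.mul_mem_left a hb⟩

/-- In a local ring two proper ideals cannot be comaximal. In the graded case the degree-zero parts
of `1 = b + a` stay in the two ideals, and one of them is a unit of the local ring `𝒜 0`. -/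
lemma Ideal.eq_top_or_powSaturation_eq_top {K : Ideal A}
    (hA : IsLocalRing A ∨ ∃ (𝒜 : ℕ → AddSubgroup A) (_ : GradedRing 𝒜), IsLocalRing (𝒜 0) ∧
      I.IsHomogeneous 𝒜 ∧ K.IsHomogeneous 𝒜)
    (h : K.powSaturation I ⊔ I = ⊤) : I = ⊤ ∨ K.powSaturation I = ⊤ := by
  rcases hA with hA | ⟨𝒜, _, h0, hI, hK⟩
  · by_contra! hne
    have := sup_le (IsLocalRing.le_maximalIdeal hne.2) (IsLocalRing.le_maximalIdeal hne.1)
    rw [h, top_le_iff] at this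
    exact Ideal.IsPrime.ne_top' this
  · classical
    obtain ⟨b, hb, a, ha, hba⟩ := Submodule.mem_sup.1 ((Ideal.eq_top_iff_one _).1 h)
    obtain ⟨n, hn⟩ := Ideal.mem_powSaturation.1 hb
    have hIn : (I ^ n).IsHomogeneous 𝒜 := by
      clear hn
      induction n with
      | zero => simpa using Ideal.IsHomogeneous.top 𝒜
      | succ n ih => rw [pow_succ]; exact ih.mul hI
    have hb0 : (DirectSum.decompose 𝒜 b 0 : A) ∈ K.powSaturation I := by
      refine Ideal.mem_powSaturation.2 ⟨n, fun c hc ↦ ?_⟩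
      -- For `c` of degree `d`, the degree-`d` part of `c * b` is `c` times the degree-zero part of
      -- `b`.
      rw [← DirectSum.sum_support_decompose 𝒜 c, Finset.sum_mul]
      refine K.sum_mem fun d _ ↦ ?_
      have hd := hK d (hn _ (hIn d hc))
      rwa [show DirectSum.decompose 𝒜 (_ * b) d = DirectSum.decompose 𝒜 (_ * b) (d + 0) from rfl,
        DirectSum.coe_decompose_mul_add_of_left_mem 𝒜 (SetLike.coe_mem _)] at hd
    have ha0 : (DirectSum.decompose 𝒜 a 0 : A) ∈ I := hI 0 ha
    have h1 : DirectSum.decompose 𝒜 b 0 + DirectSum.decompose 𝒜 a 0 = 1 := by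
      apply Subtype.ext
      have := congrArg (fun z ↦ (DirectSum.decompose 𝒜 z 0 : A)) hba
      rwa [DirectSum.decompose_of_mem_same 𝒜 SetLike.GradedOne.one_mem,
        DirectSum.decompose_add] at this
    rcases IsLocalRing.isUnit_or_isUnit_of_add_one h1 with hu | hu
    · exact Or.inr (Ideal.eq_top_of_isUnit_mem _ hb0
        (hu.map (SetLike.GradeZero.subring 𝒜).subtype))
    · exact Or.inl (Ideal.eq_top_of_isUnit_mem _ ha0
        (hu.map (SetLike.GradeZero.subring 𝒜).subtype))

end saturation

/-! ### Vanishing of all local cohomology of a cyclic module. -/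

namespace localCohomology.ExtLimit

variable {A : Type u} [CommRing A] {I : Ideal A}

/-- If the local cohomology of `A / J` vanishes in all degrees, then `J + I = A`. -/
lemma sup_eq_top_of_subsingleton [IsNoetherianRing A] (J : Ideal A)
    (h : ∀ i, Subsingleton (ExtLimit I i (ModuleCat.of A (A ⧸ J)))) : J ⊔ I = ⊤ := by
  induction J using WellFoundedGT.induction with
  | ind J ih =>
  by_cases hJ : J = ⊤
  · rw [hJ, top_sup_eq]
  -- `H^0(A / J) = 0` gives `Hom(A / I, A / J) = 0`, so `I` contains a nonzerodivisor on `A / J`.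
  obtain ⟨y, hy, hreg⟩ : ∃ y ∈ Module.annihilator A (A ⧸ I), IsSMulRegular (A ⧸ J) y := by
    rw [← IsSMulRegular.subsingleton_linearMap_iff]
    refine subsingleton_of_forall_eq 0 fun f ↦ Submodule.linearMap_qext _ (LinearMap.ext_ring ?_)
    refine subsingleton_zero_iff.1 (h 0) (f (Submodule.Quotient.mk 1)) 1 fun a ha ↦ ?_
    rw [← map_smul, ← Submodule.Quotient.mk_smul, (Submodule.Quotient.mk_eq_zero I).2, map_zero]
    simpa using ha
  rw [Ideal.annihilator_quotient] at hy
  have hlt : J < J ⊔ Ideal.span {y} := by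
    refine lt_of_le_of_ne le_sup_left fun heq ↦ hJ ?_
    have hyJ : y ∈ J := heq ▸ Ideal.mem_sup_right (Ideal.mem_span_singleton_self y)
    rw [Ideal.eq_top_iff_one, ← Submodule.Quotient.mk_eq_zero J]
    apply hreg
    change y • Submodule.Quotient.mk (p := J) 1 = y • 0
    rw [smul_zero, ← Submodule.Quotient.mk_smul, Submodule.Quotient.mk_eq_zero]
    simpa using hyJ
  have e : QuotSMulTop y (A ⧸ J) ≃ₗ[A] A ⧸ (J ⊔ Ideal.span {y}) :=
    Submodule.quotEquivOfEq _ _ (by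
      rw [← (by simp : Ideal.span {y} • (⊤ : Ideal A) = Ideal.span {y}), Submodule.map_smul'',
        Submodule.map_top, Submodule.range_mkQ, Submodule.ideal_span_singleton_smul]) ≪≫ₗ Submodule.quotientQuotientEquivQuotientSup J (Ideal.span {y})
  have := ih _ hlt fun i ↦ by
    have := h i
    have := h (i + 1)
    exact subsingleton_of_linearEquiv e
      (subsingleton_quotSMulTop (M := ModuleCat.of A (A ⧸ J)) hreg i)
  rwa [sup_assoc, sup_eq_right.2 ((Ideal.span_singleton_le_iff_mem I).2 hy)] at this

/-- `A / K.powSaturation I` is `A / K` modulo its torsion: the torsion has no higher cohomology, and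
the quotient has no torsion. -/
lemma subsingleton_powSaturation [IsNoetherianRing A] (K : Ideal A)
    (h : ∀ i, Subsingleton (ExtLimit I (i + 1) (ModuleCat.of A (A ⧸ K)))) (i : ℕ) :
    Subsingleton (ExtLimit I i (ModuleCat.of A (A ⧸ K.powSaturation I))) := by
  cases i with
  | zero =>
    rw [subsingleton_zero_iff]
    intro m n hm
    obtain ⟨b, rfl⟩ := Submodule.Quotient.mk_surjective _ m
    rw [Submodule.Quotient.mk_eq_zero]
    -- Finite generation of the torsion gives one exponent `k` for all of it, so `I ^ n b` torsion
    -- implies `I ^ (k + n) b ⊆ K`.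
    obtain ⟨k, hk⟩ := Submodule.exists_pow_smul_eq_zero_of_fg
      (IsNoetherian.noetherian (Submodule.powTorsion I (A ⧸ K))) le_rfl
    refine Ideal.mem_powSaturation.2 ⟨k + n, fun a ha ↦ ?_⟩
    rw [pow_add] at ha
    induction ha using Submodule.mul_induction_on' with
    | mem_mul_mem c hc d hd =>
      have h1 : d • b ∈ K.powSaturation I := by
        have := hm d hd
        rwa [← Submodule.Quotient.mk_smul, Submodule.Quotient.mk_eq_zero] at this
      have h2 := hk _ h1 c hc
      rw [← map_smul, Submodule.mkQ_apply, Submodule.Quotient.mk_eq_zero] at h2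
      simpa [mul_assoc] using h2
    | add c _ d _ hc hd => rw [add_mul]; exact add_mem hc hd
  | succ i =>
    let f : ModuleCat.of A (Submodule.powTorsion I (A ⧸ K)) ⟶ ModuleCat.of A (A ⧸ K) :=
      ModuleCat.ofHom (Submodule.subtype _)
    let g : ModuleCat.of A (A ⧸ K) ⟶ ModuleCat.of A (A ⧸ K.powSaturation I) :=
      ModuleCat.ofHom (Submodule.factor (K.le_powSaturation I))
    have hex : Function.Exact f g := by
      intro m
      obtain ⟨b, rfl⟩ := Submodule.Quotient.mk_surjective _ m
      change Submodule.Quotient.mk b = 0 ↔ _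
      rw [Submodule.Quotient.mk_eq_zero]
      exact ⟨fun hb ↦ ⟨⟨_, hb⟩, rfl⟩, fun ⟨z, hz⟩ ↦ by
        have := z.2
        rwa [show z.1 = Submodule.Quotient.mk b from hz] at this⟩
    have hS : (ShortComplex.mk f g (by ext z; exact (hex _).2 ⟨z, rfl⟩)).ShortExact :=
      ModuleCat.shortComplex_shortExact _ hex (Submodule.subtype_injective _)
        (Submodule.factor_surjective (K.le_powSaturation I))
    have h1 := h i
    have h2 := subsingleton_succ_of_powTorsion_eq_top (I := I) (i + 1)
      (ModuleCat.of A (Submodule.powTorsion I (A ⧸ K))) Submodule.powTorsion_powTorsion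
    exact subsingleton_X₃ hS

end localCohomology.ExtLimit

end

/-! ### The theorem. -/

open localCohomology in
theorem theorem3p1 {A : Type u} [CommRing A] [IsNoetherianRing A] (I : Ideal A) (xs : List A)
    (hA : IsLocalRing A ∨
      ∃ (𝒜 : ℕ → AddSubgroup A) (_ : GradedRing 𝒜), IsStandardGraded 𝒜 ∧
        I.IsHomogeneous 𝒜 ∧ ∀ x ∈ xs, SetLike.IsHomogeneousElem 𝒜 x)
    (hreg : RingTheory.Sequence.IsRegular A xs) (hxI : ∀ x ∈ xs, x ∈ I) :
    I.radical = (Ideal.ofList xs).radical ↔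
      IsCoregular I ((localCohomology I xs.length).obj (ModuleCat.of A A)) xs ∧
        ∀ i : ℕ, xs.length < i →
          Subsingleton ((localCohomology I i).obj (ModuleCat.of A A)) := by
  let E (i : ℕ) := extLimitEquiv I i (ModuleCat.of A A)
  let e : (A ⧸ (Ideal.ofList xs • ⊤ : Submodule A A)) ≃ₗ[A] (A ⧸ Ideal.ofList xs) :=
    Submodule.quotEquivOfEq _ _ (by simp)
  have htop : Ideal.ofList xs ≠ ⊤ := fun h ↦ hreg.top_ne_smul (by simp [h])
  have hle : Ideal.ofList xs ≤ I := Ideal.span_le.2 hxI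
  have htors (x : (localCohomology I xs.length).obj (ModuleCat.of A A)) :
      ∃ n : ℕ, ∀ a ∈ I ^ n, a • x = 0 := by
    obtain ⟨y, rfl⟩ := (E _).surjective x
    obtain ⟨n, hn⟩ := ExtLimit.exists_pow_smul_eq_zero y
    exact ⟨n, fun a ha ↦ by rw [← map_smul, hn a ha, map_zero]⟩
  have key := ExtLimit.isCoregularOn_and_subsingleton_iff hxI (M := ModuleCat.of A A)
    hreg.toIsWeaklyRegular (E xs.length).toLinearMap (E xs.length).injective
  rw [LinearEquiv.range, Submodule.isCoregularOn_top_iff] at key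
  constructor
  · intro hrad
    obtain ⟨n, hn⟩ := Ideal.exists_pow_le_of_le_radical_of_fg (hrad ▸ Ideal.le_radical)
      (IsNoetherian.noetherian I)
    have ht : Submodule.powTorsion I (A ⧸ Ideal.ofList xs) = ⊤ := by
      refine eq_top_iff.2 fun m _ ↦ ⟨n, fun a ha ↦ ?_⟩
      obtain ⟨b, rfl⟩ := Submodule.Quotient.mk_surjective _ m
      rw [← Submodule.Quotient.mk_smul, Submodule.Quotient.mk_eq_zero]
      exact Ideal.mul_mem_right _ _ (hn ha)
    obtain ⟨h₁, h₂⟩ := key.2 fun i ↦ ExtLimit.subsingleton_of_linearEquiv e.symm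
      (ExtLimit.subsingleton_succ_of_powTorsion_eq_top i _ ht)
    refine ⟨⟨?_, ?_, hxI, h₁⟩, fun i hi ↦ ?_⟩
    · by_contra hnt
      rw [not_nontrivial_iff_subsingleton] at hnt
      -- If `H^r(A)` vanished, `A / K` would have no torsion, yet its element `1` is torsion and
      -- nonzero.
      have h0 := ExtLimit.subsingleton_of_linearEquiv e (ExtLimit.subsingleton_zero_quotient
        (M := ModuleCat.of A A) hreg.toIsWeaklyRegular hxI (E _).toEquiv.subsingleton)
      obtain ⟨k, hk⟩ := Submodule.mem_powTorsion.1
        (ht ▸ Submodule.mem_top : Submodule.Quotient.mk (p := Ideal.ofList xs) 1 ∈ _)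
      have := ExtLimit.subsingleton_zero_iff.1 h0 _ k hk
      rw [Submodule.Quotient.mk_eq_zero] at this
      exact htop ((Ideal.eq_top_iff_one _).2 this)
    · intro p hp
      obtain ⟨x, hx⟩ := Module.mem_support_iff_exists_annihilator.1 hp
      obtain ⟨k, hk⟩ := htors x
      have : I ^ k ≤ p.asIdeal := fun a ha ↦
        hx ((Submodule.mem_annihilator_span_singleton x a).2 (hk a ha))
      exact Ideal.IsPrime.le_of_pow_le this
    · have := h₂ i hi
      exact (E i).symm.toEquiv.subsingleton
  · rintro ⟨hco, hvan⟩
    have hsub := key.1 ⟨hco.smul_eq, fun i hi ↦ by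
      have := hvan i hi
      exact (E i).toEquiv.subsingleton⟩
    have hsup := ExtLimit.sup_eq_top_of_subsingleton _
      (ExtLimit.subsingleton_powSaturation (I := I) (Ideal.ofList xs) fun i ↦
        ExtLimit.subsingleton_of_linearEquiv e (hsub i))
    have hA' : IsLocalRing A ∨ ∃ (𝒜 : ℕ → AddSubgroup A) (_ : GradedRing 𝒜),
        IsLocalRing (𝒜 0) ∧ I.IsHomogeneous 𝒜 ∧ (Ideal.ofList xs).IsHomogeneous 𝒜 :=
      hA.imp id fun ⟨𝒜, inst, h0, hI, hx⟩ ↦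
        ⟨𝒜, inst, h0.isLocalRing_zero, hI, Ideal.homogeneous_span 𝒜 _ hx⟩
    rcases Ideal.eq_top_or_powSaturation_eq_top hA' hsup with hI | hJ
    -- If `I = A`, then `1` lies in every `I ^ n` and kills `H^r(A)`, which is nonzero.
    · have := hco.nontrivial
      obtain ⟨x, hx⟩ := exists_ne (0 : (localCohomology I xs.length).obj (ModuleCat.of A A))
      obtain ⟨n, hn⟩ := htors x
      exact absurd ((one_smul A x).symm.trans (hn 1 (by simp [hI, Ideal.top_pow]))) hx
    · obtain ⟨n, hn⟩ := Ideal.mem_powSaturation.1 ((Ideal.eq_top_iff_one _).1 hJ)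
      refine le_antisymm ?_ (Ideal.radical_mono hle)
      rw [Ideal.radical_le_radical_iff]
      exact fun a ha ↦ ⟨n, by simpa using hn _ (Ideal.pow_mem_pow ha n)⟩
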